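/- Let $M\ge 1$ be an integer, $m\ge \tfrac12$, $\Omega>0$, $f_D>0$. Let $R_1,\dots,R_M$ be independent real random processes with almost surely continuously differentiable sample paths such that, at every time $t$, $R_i(t)$ has the Nakagami distribution with shape parameter $m$ and spread parameter $\Omega$, and $\dot R_i(t)$ is independent of $R_i(t)$ and normally distributed with mean $0$ and variance $\pi^2 f_D^2\Omega/m$ (Nakagami fading with maximum Doppler spread $f_D$ under isotropic scattering). Let $H(t)=\sum_{i=1}^M R_i(t)$. For $a<b$, let the level-crossing rate $L_H(z)$ be the expected number of times in $(a,b]$ at which $H$ crosses $z$ in the negative direction, divided by $b-a$. Put $$E=M\frac{\Gamma(m+\frac12)}{\Gamma(m)}\Big(\frac{\Omega}{m}\Big)^{1/2},\qquad V=M\Omega\Big(1-\frac1m\Big(\frac{\Gamma(m+\frac12)}{\Gamma(m)}\Big)^2\Big),\qquad \sigma_{\dot x}=\pi f_D\sqrt{\frac{M\Omega}{m}} .$$ Then: 1. For every $t$, $H(t)$ has a density $f_H$, mean $E$ and variance $V>0$, and $\Pr(H(t)\le z)=\int_{-\infty}^z f_H(x)\,dx$ for all $z$. For all $a<b$, $L_H(z)=f_H(z)\,\sigma_{\dot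 x}/\sqrt{2\pi}$ for Lebesgue-almost every $z$. 2. Let $\tilde H\sim N(E,V)$ be the Gaussian approximation of $H$, with density $f_{\tilde H}$. Replacing $f_H$ by $f_{\tilde H}$, let $$\mathcal P_o(z)=\int_{-\infty}^z f_{\tilde H}(x)\,dx,\qquad L(z)=f_{\tilde H}(z)\,\frac{\sigma_{\dot x}}{\sqrt{2\pi}},\qquad A(z)=\frac{\mathcal P_o(z)}{L(z)}$$ be the outage probability, the level-crossing rate and the average outage duration. Then for every real $z$, $$\mathcal P_o(z)=\frac12\Big[1+\operatorname{erf}\Big(\frac{z-E}{\sqrt{2V}}\Big)\Big],\qquad A(z)=\frac{2\,\mathcal P_o(z)\sqrt{mV}}{e^{-(z-E)^2/(2V)}\,f_D\,\sqrt{M\Omega}} .$$ -/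

import Mathlib

open MeasureTheory ProbabilityTheory Set Filter Topology
open scoped ENNReal

namespace RISOutage

/-- The error function. -/
noncomputable def erf (x : ℝ) : ℝ :=
  2 / √Real.pi * ∫ u in (0 : ℝ)..x, Real.exp (-u ^ 2)

/-- The Nakagami density with shape parameter `m` and spread parameter `Ω`. -/
noncomputable def nakagamiPDF (m Ω x : ℝ) : ℝ :=
  if 0 ≤ x then
    2 * m ^ m / (Real.Gamma m * Ω ^ m) * x ^ (2 * m - 1) * Real.exp (-m * x ^ 2 / Ω)
  else 0

/-- The Nakagami distribution. -/
noncomputable def nakagamiMeasure (m Ω : ℝ) : Measure ℝ :=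
  volume.withDensity fun x => ENNReal.ofReal (nakagamiPDF m Ω x)

/-- `R i t` is the fading envelope of the link through element `i` at time `t`. The `M` envelopes
are independent random processes with continuously differentiable sample paths. At every time the
envelope is Nakagami distributed, and its time derivative is independent of it and centred
Gaussian with variance `π² f_D² Ω / m` (isotropic scattering, maximum Doppler spread `f_D`). -/
structure IsNakagamiFading {S : Type*} [MeasurableSpace S] (μ : Measure S) {M : ℕ}
    (m Ω fD : ℝ) (R : Fin M → ℝ → S → ℝ) : Prop where
  measurable : ∀ i t, Measurable (R i t)
  contDiff : ∀ i, ∀ᵐ ω ∂μ, ContDiff ℝ 1 fun t => R i t ω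
  indep : iIndepFun (fun i ω t => R i t ω) μ
  law : ∀ i t, μ.map (fun ω => (R i t ω, deriv (fun s => R i s ω) t)) =
    (nakagamiMeasure m Ω).prod (gaussianReal 0 (Real.pi ^ 2 * fD ^ 2 * Ω / m).toNNReal)

/-- The channel coefficient `H(t)`, the sum of the envelopes. -/
def channel {S : Type*} {M : ℕ} (R : Fin M → ℝ → S → ℝ) (t : ℝ) (ω : S) : ℝ :=
  ∑ i, R i t ω

/-- The path `x` crosses the level `z` in the negative direction at time `t`. -/
def IsDowncrossing (x : ℝ → ℝ) (z t : ℝ) : Prop :=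
  x t = z ∧ (∀ᶠ s in 𝓝[<] t, z < x s) ∧ (∀ᶠ s in 𝓝[>] t, x s < z)

/-- The level crossing rate: expected number per unit of time, over the interval `(a, b]`, of
the crossings of the level `z` by the process `X` in the negative direction. -/
noncomputable def levelCrossingRate {S : Type*} [MeasurableSpace S] (μ : Measure S)
    (X : ℝ → S → ℝ) (a b z : ℝ) : ℝ≥0∞ :=
  (∫⁻ ω, ({t ∈ Ioc a b | IsDowncrossing (fun s => X s ω) z t}.encard : ℝ≥0∞) ∂μ) /
    ENNReal.ofReal (b - a)

/-- The mean of the Gaussian approximation of the channel coefficient. -/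
noncomputable def approxMean (M : ℕ) (m Ω : ℝ) : ℝ :=
  M * (Real.Gamma (m + 1 / 2) / Real.Gamma m) * (Ω / m) ^ (1 / 2 : ℝ)

/-- The variance of the Gaussian approximation of the channel coefficient. -/
noncomputable def approxVar (M : ℕ) (m Ω : ℝ) : ℝ :=
  M * Ω * (1 - 1 / m * (Real.Gamma (m + 1 / 2) / Real.Gamma m) ^ 2)

/-- The density of the Gaussian approximation of the channel coefficient. -/
noncomputable def approxPDF (M : ℕ) (m Ω : ℝ) : ℝ → ℝ :=
  gaussianPDFReal (approxMean M m Ω) (approxVar M m Ω).toNNReal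

/-- The standard deviation of the time derivative of the channel coefficient. -/
noncomputable def sigmaDot (M : ℕ) (m Ω fD : ℝ) : ℝ :=
  Real.pi * fD * √(M * Ω / m)

/-- The probability that a variable with density `f` is at most `z`. -/
noncomputable def outageOfPDF (f : ℝ → ℝ) (z : ℝ) : ℝ :=
  ∫ x in Iic z, f x

/-- The level crossing rate computed from the density `f` of the channel coefficient. -/
noncomputable def rateOfPDF (f : ℝ → ℝ) (σ z : ℝ) : ℝ :=
  f z * (σ / √(2 * Real.pi))

/-- The average outage duration computed from the density `f` of the channel coefficient:
outage probability divided by level crossing rate. -/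
noncomputable def aodOfPDF (f : ℝ → ℝ) (σ z : ℝ) : ℝ :=
  outageOfPDF f z / rateOfPDF f σ z

end RISOutage

/-! The exact level-crossing rate is Rice's formula. For a single `C¹` path `x`, the area formula
`lintegral_encard_mul` says that integrating over levels `z` in `B` the number of times with `x t =
z` and `x' t < 0` gives the time integral of the negative part of `x'` over the times when `x t`
lies in `B`. Critical values form a null set, so for almost every `z` these times are exactly the
downcrossings. Taking expectations and using that the value and derivative are independent at each
time, the right side becomes `b - a` times the mean negative part of the derivative times the
probability of `B`. As `B` is arbitrary, densities agree for almost every level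
(`lintegral_encard_isDowncrossing`).

For the channel, independence of the paths and of each envelope from its own derivative makes the
sum independent of its derivative, a centred Gaussian of variance `σ²` whose mean negative part is
`σ / √(2π)`. The mean and variance come from Nakagami moments, which are Gamma integrals. The
Gaussian formulas are a substitution of one density for another: no approximation error is
estimated. -/

namespace RISOutage

/-! ### Measurability of the number of zeros of a continuous process -/

section Counting

/-- Two points fall into different cells of the grid of mesh `1 / (n + 1)` once the mesh is below
their distance, and a finite set has finitely many pairs. -/
theorem exists_injOn_ceil_mul {s : Set ℝ} (hs : s.Finite) :
    ∃ n : ℕ, InjOn (fun t : ℝ => ⌈((n : ℝ) + 1) * t⌉) s := by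
  have key : ∀ x y : ℝ, ∀ᶠ n : ℕ in atTop, ⌈((n : ℝ) + 1) * x⌉ = ⌈((n : ℝ) + 1) * y⌉ → x = y := by
    have aux : ∀ x y : ℝ, x < y →
        ∀ᶠ n : ℕ in atTop, ⌈((n : ℝ) + 1) * x⌉ < ⌈((n : ℝ) + 1) * y⌉ := by
      intro x y hxy
      filter_upwards [eventually_ge_atTop ⌈1 / (y - x)⌉₊] with n hn
      have h1 : 1 / (y - x) ≤ (n : ℝ) := (Nat.le_ceil _).trans (by exact_mod_cast hn)
      rw [div_le_iff₀ (sub_pos.2 hxy)] at h1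
      have h2 := Int.ceil_lt_add_one (((n : ℝ) + 1) * x)
      have h3 := Int.le_ceil (((n : ℝ) + 1) * y)
      have : ((⌈((n : ℝ) + 1) * x⌉ : ℤ) : ℝ) < ⌈((n : ℝ) + 1) * y⌉ := by nlinarith
      exact_mod_cast this
    intro x y
    rcases lt_trichotomy x y with h | h | h
    · filter_upwards [aux x y h] with n hn h'
      omega
    · simp [h]
    · filter_upwards [aux y x h] with n hn h'
      omega
  have h : ∀ᶠ n : ℕ in atTop, ∀ x ∈ s, ∀ y ∈ s,
      ⌈((n : ℝ) + 1) * x⌉ = ⌈((n : ℝ) + 1) * y⌉ → x = y := by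
    rw [eventually_all_finite hs]
    intro x _
    rw [eventually_all_finite hs]
    exact fun y _ => key x y
  obtain ⟨n, hn⟩ := h.exists
  exact ⟨n, fun x hx y hy hxy => hn x hx y hy hxy⟩

theorem tsum_indicator_one_eq_encard {α : Type*} (s : Set α) :
    ∑' k, s.indicator (fun _ => (1 : ℝ≥0∞)) k = s.encard := by
  rw [← tsum_subtype, ENNReal.tsum_set_one]

/-- The number of points of a set of reals, as a supremum over grids of the number of cells met. -/
theorem encard_eq_iSup_encard_image_ceil (s : Set ℝ) :
    (s.encard : ℝ≥0∞) =
      ⨆ n : ℕ, ((((fun t : ℝ => ⌈((n : ℝ) + 1) * t⌉) '' s).encard : ℕ∞) : ℝ≥0∞) := by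
  refine le_antisymm ?_ (iSup_le fun n => by exact_mod_cast encard_image_le _ _)
  have key : ∀ t ⊆ s, t.Finite → (t.encard : ℝ≥0∞) ≤
      ⨆ n : ℕ, ((((fun t : ℝ => ⌈((n : ℝ) + 1) * t⌉) '' s).encard : ℕ∞) : ℝ≥0∞) := by
    intro t hts ht
    obtain ⟨n, hn⟩ := exists_injOn_ceil_mul ht
    refine le_trans ?_ (le_iSup _ n)
    rw [← hn.encard_image]
    exact_mod_cast encard_le_encard (image_mono hts)
  rcases s.finite_or_infinite with h | h
  · exact key s subset_rfl h
  -- An infinite set has finite subsets of every size, so the supremum exceeds every natural number.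
  · have : ∀ k : ℕ, (k : ℝ≥0∞) ≤
        ⨆ n : ℕ, ((((fun t : ℝ => ⌈((n : ℝ) + 1) * t⌉) '' s).encard : ℕ∞) : ℝ≥0∞) := by
      intro k
      obtain ⟨t, ht, hk⟩ := exists_subset_encard_eq (s := s) (k := k) (by simp [h.encard_eq])
      have hf : t.Finite := finite_of_encard_eq_coe hk
      simpa [hk] using key t ht hf
    refine le_top.trans_eq (ENNReal.eq_top_of_forall_nnreal_le fun r => ?_).symm
    obtain ⟨k, hk⟩ := exists_nat_ge r
    exact le_trans (by exact_mod_cast hk) (this k)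

variable {α : Type*} [MeasurableSpace α] {F : ℝ → α → ℝ}

/-- By compactness, a zero exists exactly when `|F|` takes arbitrarily small values on a countable
dense subset, which is a countable condition on `p`. -/
theorem measurableSet_exists_mem_Icc_eq_zero (hc : ∀ p, Continuous fun t => F t p)
    (hm : ∀ t, Measurable (F t)) (c d : ℝ) :
    MeasurableSet {p | ∃ t ∈ Icc c d, F t p = 0} := by
  obtain ⟨D, hD, hd⟩ := TopologicalSpace.exists_countable_dense (Icc c d)
  have : {p | ∃ t ∈ Icc c d, F t p = 0} =
      ⋂ n : ℕ, ⋃ q ∈ D, {p | |F q p| < 1 / ((n : ℝ) + 1)} := by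
    ext p
    simp only [mem_ofPred_eq, mem_iInter, mem_iUnion, exists_prop]
    constructor
    · rintro ⟨t, ht, h0⟩ n
      have ho : IsOpen {q : Icc c d | |F q p| < 1 / ((n : ℝ) + 1)} :=
        isOpen_lt (((hc p).comp continuous_subtype_val).abs) continuous_const
      obtain ⟨q, hq, hqD⟩ := hd.exists_mem_open ho
        ⟨⟨t, ht⟩, by simp only [mem_ofPred_eq, h0, abs_zero]; positivity⟩
      exact ⟨q, hq, hqD⟩
    · intro h
      -- Only needed to see that the interval is nonempty, so that the minimum of `|F|` is attained.
      obtain ⟨q, -, -⟩ := h 0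
      obtain ⟨t, ht, hmin⟩ := (isCompact_Icc (a := c) (b := d)).exists_isMinOn ⟨q, q.2⟩
        ((hc p).abs.continuousOn)
      refine ⟨t, ht, ?_⟩
      by_contra h0
      obtain ⟨n, hn⟩ := exists_nat_one_div_lt (abs_pos.2 h0)
      obtain ⟨r, -, hr⟩ := h n
      exact absurd (hmin r.2) (not_le.2 (hr.trans hn))
  rw [this]
  exact MeasurableSet.iInter fun n => MeasurableSet.biUnion hD fun q _ =>
    measurableSet_lt (hm q).abs measurable_const

theorem measurableSet_exists_mem_Ioc_eq_zero (hc : ∀ p, Continuous fun t => F t p)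
    (hm : ∀ t, Measurable (F t)) (c d : ℝ) :
    MeasurableSet {p | ∃ t ∈ Ioc c d, F t p = 0} := by
  have : {p | ∃ t ∈ Ioc c d, F t p = 0} =
      ⋃ n : ℕ, {p | ∃ t ∈ Icc (c + 1 / ((n : ℝ) + 1)) d, F t p = 0} := by
    ext p
    simp only [mem_ofPred_eq, mem_iUnion]
    constructor
    · rintro ⟨t, ht, h0⟩
      obtain ⟨n, hn⟩ := exists_nat_one_div_lt (sub_pos.2 ht.1)
      exact ⟨n, t, ⟨by linarith, ht.2⟩, h0⟩
    · rintro ⟨n, t, ht, h0⟩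
      have : (0 : ℝ) < 1 / ((n : ℝ) + 1) := by positivity
      exact ⟨t, ⟨by linarith [ht.1], ht.2⟩, h0⟩
  rw [this]
  exact MeasurableSet.iUnion fun n => measurableSet_exists_mem_Icc_eq_zero hc hm _ _

/-- The number of zeros of a continuous process in an interval is measurable. -/
theorem measurable_encard_zeros (hc : ∀ p, Continuous fun t => F t p)
    (hm : ∀ t, Measurable (F t)) (a b : ℝ) :
    Measurable fun p => ({t ∈ Ioc a b | F t p = 0}.encard : ℝ≥0∞) := by
  simp_rw [encard_eq_iSup_encard_image_ceil, ← tsum_indicator_one_eq_encard]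
  refine Measurable.iSup fun n => Measurable.tsum fun k => ?_
  have hn : (0 : ℝ) < (n : ℝ) + 1 := by positivity
  -- Cell `k` of the grid is `((k - 1) / (n + 1), k / (n + 1)]`; it is met exactly when there is a
  -- zero in its intersection with `(a, b]`, again a half-open interval.
  have : ∀ p, ((fun t : ℝ => ⌈((n : ℝ) + 1) * t⌉) '' {t ∈ Ioc a b | F t p = 0}).indicator
      (fun _ => (1 : ℝ≥0∞)) k =
      {p | ∃ t ∈ Ioc (a ⊔ ((k : ℝ) - 1) / ((n : ℝ) + 1)) (b ⊓ (k : ℝ) / ((n : ℝ) + 1)),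
        F t p = 0}.indicator (fun _ => (1 : ℝ≥0∞)) p := by
    intro p
    refine indicator_eq_indicator ?_ rfl
    simp only [mem_image, mem_ofPred_eq, ← Ioc_inter_Ioc, mem_inter_iff, mem_Ioc, Int.ceil_eq_iff,
      div_lt_iff₀ hn, le_div_iff₀ hn]
    refine exists_congr fun t => ?_
    rw [mul_comm t]
    tauto
  simp_rw [this]
  exact measurable_const.indicator (measurableSet_exists_mem_Ioc_eq_zero hc hm _ _)

end Counting

/-! ### Area formula and downcrossings of one path -/

section Area

variable {x x' : ℝ → ℝ}

/-- Sard's theorem in dimension one: the differential has zero determinant on the critical set. -/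
theorem volume_image_deriv_eq_zero (hx : ∀ t, HasDerivAt x (x' t) t) :
    volume (x '' {t | x' t = 0}) = 0 := by
  refine addHaar_image_eq_zero_of_det_fderivWithin_eq_zero volume
    (f' := fun t => ContinuousLinearMap.toSpanSingleton ℝ (x' t))
    (fun t _ => (hx t).hasFDerivAt.hasFDerivWithinAt) ?_
  intro t ht
  simpa [ContinuousLinearMap.det_toSpanSingleton] using ht

open Classical in
-- The open set where `x' < 0` is a countable union of rational intervals, on each of which `x` is
-- strictly decreasing. Making them disjoint gives pieces on which the injective change of variables
-- applies.
theorem exists_pairwise_disjoint_injOn (hx : ∀ t, HasDerivAt x (x' t) t) (hx' : Continuous x') :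
    ∃ V : ℕ → Set ℝ, (∀ n, MeasurableSet (V n)) ∧ (∀ n, InjOn x (V n)) ∧
      Pairwise (Function.onFun Disjoint V) ∧ ⋃ n, V n = {t | x' t < 0} := by
  set U : Set ℝ := {t | x' t < 0}
  have hU : IsOpen U := isOpen_lt hx' continuous_const
  -- Rational intervals not contained in `U` are replaced by `∅`, so all rational pairs can be
  -- enumerated at once.
  obtain ⟨V, hV⟩ := ((countable_univ (α := ℚ × ℚ)).image
    (fun p => if Ioo (p.1 : ℝ) p.2 ⊆ U then Ioo (p.1 : ℝ) p.2 else ∅)).exists_eq_range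
    ((univ_nonempty).image _)
  have hVn : ∀ n, V n ⊆ U ∧ MeasurableSet (V n) ∧ InjOn x (V n) := by
    intro n
    have : V n ∈ range V := mem_range_self n
    rw [← hV] at this
    obtain ⟨p, -, hp⟩ := this
    dsimp only at hp
    split_ifs at hp with h
    · rw [← hp]
      refine ⟨h, measurableSet_Ioo, ?_⟩
      refine (strictAntiOn_of_deriv_neg (convex_Ioo _ _)
        (fun t _ => (hx t).continuousAt.continuousWithinAt) fun t ht => ?_).injOn
      rw [interior_Ioo] at ht
      rw [(hx t).deriv]
      exact h ht
    · simp [← hp]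
  refine ⟨disjointed V, fun n => ?_, fun n => ?_, disjoint_disjointed V, ?_⟩
  · exact disjointedRec (fun _ i h => h.diff (hVn i).2.1) (hVn n).2.1
  · exact (hVn n).2.2.mono (disjointed_subset V n)
  · rw [iUnion_disjointed]
    refine subset_antisymm (iUnion_subset fun n => (hVn n).1) fun t ht => ?_
    obtain ⟨B, hB, htB, hBU⟩ := Real.isTopologicalBasis_Ioo_rat.exists_subset_of_mem_open ht hU
    simp only [mem_iUnion, mem_singleton_iff] at hB
    obtain ⟨p, q, -, rfl⟩ := hB
    have : Ioo (p : ℝ) q ∈ range V := by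
      rw [← hV]
      exact ⟨(p, q), mem_univ _, by simp [hBU]⟩
    obtain ⟨n, hn⟩ := this
    exact mem_iUnion.2 ⟨n, hn ▸ htB⟩

/-- Area formula with multiplicity for the decreasing part of a `C¹` function of one variable. -/
theorem lintegral_encard_mul (hx : ∀ t, HasDerivAt x (x' t) t) (hx' : Continuous x')
    {s : Set ℝ} (hs : MeasurableSet s) {g : ℝ → ℝ≥0∞} (hg : Measurable g) :
    ∫⁻ z, ({t ∈ s | x t = z ∧ x' t < 0}.encard : ℝ≥0∞) * g z =
      ∫⁻ t in s, ENNReal.ofReal (-x' t) * g (x t) := by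
  obtain ⟨V, hVm, hVi, hVd, hVU⟩ := exists_pairwise_disjoint_injOn hx hx'
  have hxc : Continuous x := continuous_iff_continuousAt.2 fun t => (hx t).continuousAt
  have hmeas : ∀ n, MeasurableSet (x '' (s ∩ V n)) := fun n =>
    (hs.inter (hVm n)).image_of_continuousOn_injOn hxc.continuousOn
      ((hVi n).mono inter_subset_right)
  -- By injectivity each piece contributes at most one point over `z`, so the count is a sum of
  -- indicators of images.
  have hcount : ∀ z, ({t ∈ s | x t = z ∧ x' t < 0}.encard : ℝ≥0∞) =
      ∑' n, (x '' (s ∩ V n)).indicator (fun _ => 1) z := by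
    intro z
    have hsub : ∀ n, ({t ∈ s ∩ V n | x t = z}).Subsingleton := fun n t ht u hu =>
      hVi n ht.1.2 hu.1.2 (ht.2.trans hu.2.symm)
    have hA : {t ∈ s | x t = z ∧ x' t < 0} = ⋃ n, {t ∈ s ∩ V n | x t = z} := by
      ext t
      have : x' t < 0 ↔ ∃ n, t ∈ V n := by
        rw [← mem_iUnion, hVU, mem_ofPred_eq]
      simp only [mem_ofPred_eq, mem_iUnion, mem_inter_iff, this]
      constructor
      · rintro ⟨h1, h2, n, hn⟩
        exact ⟨n, ⟨h1, hn⟩, h2⟩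
      · rintro ⟨n, ⟨h1, hn⟩, h2⟩
        exact ⟨h1, h2, n, hn⟩
    have hmA : ∀ n, MeasurableSet {t ∈ s ∩ V n | x t = z} := fun n => (hsub n).measurableSet
    rw [hA, ← Measure.count_apply (MeasurableSet.iUnion hmA), measure_iUnion _ hmA]
    · refine tsum_congr fun n => ?_
      rw [Measure.count_apply (hmA n)]
      by_cases h : z ∈ x '' (s ∩ V n)
      · rw [indicator_of_mem h]
        obtain ⟨t, ht, hz⟩ := h
        have : {t ∈ s ∩ V n | x t = z} = {t} :=
          (hsub n).eq_singleton_of_mem ⟨ht, hz⟩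
        rw [this]
        simp
      · rw [indicator_of_notMem h]
        have : {t ∈ s ∩ V n | x t = z} = ∅ :=
          eq_empty_of_forall_notMem fun t ht => h ⟨t, ht.1, ht.2⟩
        rw [this]
        simp
    · intro i j hij
      exact (hVd hij).mono (fun t ht => ht.1.2) (fun t ht => ht.1.2)
  have hx'm : Measurable x' := hx'.measurable
  simp_rw [hcount, ← ENNReal.tsum_mul_right]
  rw [lintegral_tsum (f := fun n z => (x '' (s ∩ V n)).indicator (fun _ => 1) z * g z)
    fun n => ((measurable_const.indicator (hmeas n)).mul hg).aemeasurable]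
  have hterm : ∀ n, ∫⁻ z, (x '' (s ∩ V n)).indicator (fun _ => 1) z * g z =
      ∫⁻ t in s ∩ V n, ENNReal.ofReal (-x' t) * g (x t) := by
    intro n
    have : ∀ z, (x '' (s ∩ V n)).indicator (fun _ => 1) z * g z =
        (x '' (s ∩ V n)).indicator g z := by
      intro z
      by_cases h : z ∈ x '' (s ∩ V n) <;> simp [h]
    simp_rw [this]
    rw [lintegral_indicator (hmeas n), lintegral_image_eq_lintegral_abs_deriv_mul
      (hs.inter (hVm n)) (fun t _ => (hx t).hasDerivWithinAt) ((hVi n).mono inter_subset_right)]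
    refine setLIntegral_congr_fun (hs.inter (hVm n)) fun t ht => ?_
    have : t ∈ {t | x' t < 0} := hVU ▸ mem_iUnion.2 ⟨n, ht.2⟩
    rw [abs_of_neg this]
  simp_rw [hterm]
  rw [← lintegral_iUnion (fun n => hs.inter (hVm n))
    (fun i j hij => (hVd hij).mono inter_subset_right inter_subset_right),
    ← inter_iUnion, hVU]
  have hU : MeasurableSet {t | x' t < 0} := measurableSet_lt hx'm measurable_const
  -- Restricting to `x' < 0` can be dropped, as `ENNReal.ofReal (-x' t)` vanishes elsewhere.
  rw [inter_comm, ← Measure.restrict_restrict hU, ← lintegral_indicator hU]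
  refine lintegral_congr fun t => ?_
  by_cases h : x' t < 0
  · rw [indicator_of_mem (show t ∈ {t | x' t < 0} from h)]
  · rw [indicator_of_notMem (show t ∉ {t | x' t < 0} from h),
      ENNReal.ofReal_of_nonpos (by linarith), zero_mul]

theorem isDowncrossing_of_deriv_neg {z t : ℝ} (hx : HasDerivAt x (x' t) t) (hz : x t = z)
    (h : x' t < 0) : IsDowncrossing x z t := by
  have hs := (hasDerivAt_iff_tendsto_slope.1 hx).eventually (gt_mem_nhds h)
  refine ⟨hz, ?_, ?_⟩
  · filter_upwards [hs.filter_mono (nhdsWithin_mono t (fun s (hs : s < t) => ne_of_lt hs)),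
      self_mem_nhdsWithin] with s h1 (h2 : s < t)
    rw [slope_def_field, div_neg_iff] at h1
    rcases h1 with h1 | h1 <;> linarith
  · filter_upwards [hs.filter_mono (nhdsWithin_mono t (fun s (hs : t < s) => ne_of_gt hs)),
      self_mem_nhdsWithin] with s h1 (h2 : t < s)
    rw [slope_def_field, div_neg_iff] at h1
    rcases h1 with h1 | h1 <;> linarith

theorem IsDowncrossing.deriv_nonpos {z t : ℝ} (h : IsDowncrossing x z t)
    (hx : HasDerivAt x (x' t) t) : x' t ≤ 0 := by
  by_contra! h0
  have hs := (hasDerivAt_iff_tendsto_slope.1 hx).eventually (lt_mem_nhds h0)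
  have h1 : ∀ᶠ s in 𝓝[>] t, 0 < slope x t s :=
    hs.filter_mono (nhdsWithin_mono t (fun s (hs : t < s) => ne_of_gt hs))
  obtain ⟨s, h2, h3, h4 : t < s⟩ := (h1.and (h.2.2.and self_mem_nhdsWithin)).exists
  rw [slope_def_field, h.1, div_pos_iff] at h2
  rcases h2 with h2 | h2 <;> linarith

/-- A negative derivative forces a downcrossing and a positive one excludes it; only the zero
derivative is ambiguous. The closed condition `x' t ≤ 0` is kept because it can be encoded as the
vanishing of a continuous function. -/
theorem setOf_isDowncrossing_eq (hx : ∀ t, HasDerivAt x (x' t) t) {s : Set ℝ} {z : ℝ}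
    (hz : ¬ ∃ t ∈ s, x t = z ∧ x' t = 0) :
    {t ∈ s | IsDowncrossing x z t} = {t ∈ s | x t = z ∧ x' t ≤ 0} := by
  ext t
  refine and_congr_right fun ht => ⟨fun h => ⟨h.1, h.deriv_nonpos (hx t)⟩, fun h => ?_⟩
  exact isDowncrossing_of_deriv_neg (hx t) h.1
    (lt_of_le_of_ne h.2 fun h0 => hz ⟨t, ht, h.1, h0⟩)

end Area

/-! ### Rice's formula -/

section Rice

variable {S : Type*} [MeasurableSpace S] {μ : Measure S} {Y Y' : ℝ → S → ℝ}

/-- Both conditions say that the single continuous function `|Y - z| + max Y' 0` vanishes, so its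
zeros can be counted measurably in `(z, ω)`. -/
theorem measurable_encard_downward (hY : ∀ t, Measurable (Y t)) (hY' : ∀ t, Measurable (Y' t))
    (hYc : ∀ ω, Continuous fun t => Y t ω) (hYc' : ∀ ω, Continuous fun t => Y' t ω) (a b : ℝ) :
    Measurable fun p : ℝ × S =>
      ({t ∈ Ioc a b | Y t p.2 = p.1 ∧ Y' t p.2 ≤ 0}.encard : ℝ≥0∞) := by
  have h := measurable_encard_zeros (α := ℝ × S)
    (F := fun t p => |Y t p.2 - p.1| + max (Y' t p.2) 0)
    (fun p => ((hYc p.2).sub continuous_const).abs.add ((hYc' p.2).max continuous_const))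
    (fun t => (((hY t).comp measurable_snd).sub measurable_fst).abs.add
      (((hY' t).comp measurable_snd).max measurable_const)) a b
  have heq : ∀ (p : ℝ × S) (t : ℝ), |Y t p.2 - p.1| + max (Y' t p.2) 0 = 0 ↔
      (Y t p.2 = p.1 ∧ Y' t p.2 ≤ 0) := fun p t => by
    rw [add_eq_zero_iff_of_nonneg (abs_nonneg _) (le_max_right _ _), abs_eq_zero, sub_eq_zero,
      max_eq_right_iff]
  simpa only [heq] using h

theorem measurableSet_critical_value (hY : ∀ t, Measurable (Y t)) (hY' : ∀ t, Measurable (Y' t))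
    (hYc : ∀ ω, Continuous fun t => Y t ω) (hYc' : ∀ ω, Continuous fun t => Y' t ω) (a b : ℝ) :
    MeasurableSet {p : ℝ × S | ∃ t ∈ Ioc a b, Y t p.2 = p.1 ∧ Y' t p.2 = 0} := by
  have h := measurableSet_exists_mem_Ioc_eq_zero (α := ℝ × S)
    (F := fun t p => |Y t p.2 - p.1| + |Y' t p.2|)
    (fun p => ((hYc p.2).sub continuous_const).abs.add (hYc' p.2).abs)
    (fun t => (((hY t).comp measurable_snd).sub measurable_fst).abs.add
      ((hY' t).comp measurable_snd).abs) a b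
  have heq : ∀ (p : ℝ × S) (t : ℝ), |Y t p.2 - p.1| + |Y' t p.2| = 0 ↔
      (Y t p.2 = p.1 ∧ Y' t p.2 = 0) := fun p t => by
    rw [add_eq_zero_iff_of_nonneg (abs_nonneg _) (abs_nonneg _), abs_eq_zero, sub_eq_zero,
      abs_eq_zero]
  simpa only [heq] using h

/-- Rice's formula for a `C¹` process whose derivative at each time is independent of its value. -/
theorem lintegral_encard_isDowncrossing [SFinite μ]
    (hY : ∀ t, Measurable (Y t)) (hY' : ∀ t, Measurable (Y' t))
    (hd : ∀ ω t, HasDerivAt (fun s => Y s ω) (Y' t ω) t)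
    (hYc' : ∀ ω, Continuous fun t => Y' t ω) {ν γ : Measure ℝ} [SFinite ν] [SFinite γ]
    (hlaw : ∀ t, μ.map (fun ω => (Y t ω, Y' t ω)) = ν.prod γ)
    {f : ℝ → ℝ≥0∞} (hf : Measurable f) (hν : ν = volume.withDensity f) (a b : ℝ) :
    ∀ᵐ z : ℝ, ∫⁻ ω, ({t ∈ Ioc a b | IsDowncrossing (fun s => Y s ω) z t}.encard : ℝ≥0∞) ∂μ =
      ENNReal.ofReal (b - a) * (∫⁻ y, ENNReal.ofReal (-y) ∂γ) * f z := by
  have hYc : ∀ ω, Continuous fun t => Y t ω := fun ω =>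
    continuous_iff_continuousAt.2 fun t => (hd ω t).continuousAt
  have hN := measurable_encard_downward hY hY' hYc hYc' a b
  have hcrit : ∀ ω, ∀ᵐ z : ℝ, ¬ ∃ t ∈ Ioc a b, Y t ω = z ∧ Y' t ω = 0 := by
    intro ω
    refine measure_mono_null ?_ (volume_image_deriv_eq_zero (hd ω))
    intro z hz
    simp only [mem_compl_iff, mem_ofPred_eq, not_not] at hz
    obtain ⟨t, -, h1, h2⟩ := hz
    exact ⟨t, h2, h1⟩
  -- Fubini turns a null set of levels for every path into a null set of paths for almost every
  -- level.
  have hcrit' : ∀ᵐ z : ℝ, ∀ᵐ ω ∂μ, ¬ ∃ t ∈ Ioc a b, Y t ω = z ∧ Y' t ω = 0 :=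
    (Measure.ae_ae_comm (p := fun (z : ℝ) (ω : S) => ¬ ∃ t ∈ Ioc a b, Y t ω = z ∧ Y' t ω = 0)
      (measurableSet_critical_value hY hY' hYc hYc' a b).compl).2 (ae_of_all _ hcrit)
  have hmean : ∀ᵐ z : ℝ,
      ∫⁻ ω, ({t ∈ Ioc a b | Y t ω = z ∧ Y' t ω ≤ 0}.encard : ℝ≥0∞) ∂μ =
      ENNReal.ofReal (b - a) * (∫⁻ y, ENNReal.ofReal (-y) ∂γ) * f z := by
    -- Almost everywhere equality in `z` is tested by integrating over arbitrary measurable sets `B`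
    -- of levels.
    refine ae_eq_of_forall_setLIntegral_eq_of_sigmaFinite hN.lintegral_prod_right
      (hf.const_mul _) fun B hB _ => ?_
    have hBm : Measurable (B.indicator (1 : ℝ → ℝ≥0∞)) := measurable_one.indicator hB
    have hYu : Measurable fun p : ℝ × S => Y p.1 p.2 :=
      measurable_uncurry_of_continuous_of_measurable hYc hY
    have hYu' : Measurable fun p : ℝ × S => Y' p.1 p.2 :=
      measurable_uncurry_of_continuous_of_measurable hYc' hY'
    have hNω : ∀ ω, ∫⁻ z in B, ({t ∈ Ioc a b | Y t ω = z ∧ Y' t ω ≤ 0}.encard : ℝ≥0∞) =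
        ∫⁻ t in Ioc a b, ENNReal.ofReal (-Y' t ω) * B.indicator 1 (Y t ω) := by
      intro ω
      rw [← lintegral_encard_mul (hd ω) (hYc' ω) measurableSet_Ioc hBm, ← lintegral_indicator hB]
      refine lintegral_congr_ae ?_
      filter_upwards [hcrit ω] with z hz
      have : {t ∈ Ioc a b | Y t ω = z ∧ Y' t ω ≤ 0} =
          {t ∈ Ioc a b | Y t ω = z ∧ Y' t ω < 0} := by
        ext t
        refine and_congr_right fun ht => and_congr_right fun h1 =>
          ⟨fun h => lt_of_le_of_ne h fun h0 => hz ⟨t, ht, h1, h0⟩, le_of_lt⟩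
      by_cases hzB : z ∈ B
      · rw [indicator_of_mem hzB, indicator_of_mem hzB, this, Pi.one_apply, mul_one]
      · simp [hzB]
    -- Independence enters here: the joint law is a product, so the expectation factors.
    have hYt : ∀ t, ∫⁻ ω, ENNReal.ofReal (-Y' t ω) * B.indicator 1 (Y t ω) ∂μ =
        ν B * ∫⁻ y, ENNReal.ofReal (-y) ∂γ := by
      intro t
      have hg : Measurable fun y : ℝ => ENNReal.ofReal (-y) := measurable_neg.ennreal_ofReal
      rw [← lintegral_indicator_one hB, ← lintegral_prod_mul hBm.aemeasurable hg.aemeasurable,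
        ← hlaw t, lintegral_map (f := fun z : ℝ × ℝ => B.indicator 1 z.1 * ENNReal.ofReal (-z.2))
          ((hBm.comp measurable_fst).mul (hg.comp measurable_snd)) ((hY t).prodMk (hY' t))]
      exact lintegral_congr fun ω => mul_comm _ _
    calc ∫⁻ z in B, ∫⁻ ω, ({t ∈ Ioc a b | Y t ω = z ∧ Y' t ω ≤ 0}.encard : ℝ≥0∞) ∂μ
        = ∫⁻ ω, (∫⁻ z in B, ({t ∈ Ioc a b | Y t ω = z ∧ Y' t ω ≤ 0}.encard : ℝ≥0∞)) ∂μ :=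
          lintegral_lintegral_swap hN.aemeasurable
      _ = ∫⁻ ω, (∫⁻ t in Ioc a b, ENNReal.ofReal (-Y' t ω) * B.indicator 1 (Y t ω)) ∂μ :=
          lintegral_congr hNω
      _ = ∫⁻ t in Ioc a b, ∫⁻ ω, ENNReal.ofReal (-Y' t ω) * B.indicator 1 (Y t ω) ∂μ :=
          (lintegral_lintegral_swap
            (hYu'.neg.ennreal_ofReal.mul (hBm.comp hYu)).aemeasurable).symm
      _ = ENNReal.ofReal (b - a) * (∫⁻ y, ENNReal.ofReal (-y) ∂γ) * ν B := by
          simp_rw [hYt]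
          rw [setLIntegral_const, Real.volume_Ioc]
          ring
      _ = _ := by rw [lintegral_const_mul _ hf, hν, withDensity_apply _ hB]
  filter_upwards [hcrit', hmean] with z hz hm
  rw [← hm]
  refine lintegral_congr_ae ?_
  filter_upwards [hz] with ω hω
  rw [setOf_isDowncrossing_eq (hd ω) hω]

/-- A version of the derivative at `t` that is a measurable function of the whole path. -/
noncomputable def pathDeriv (t : ℝ) (x : ℝ → ℝ) : ℝ :=
  limsup (fun n : ℕ => ((n : ℝ) + 1) * (x (t + 1 / ((n : ℝ) + 1)) - x t)) atTop

theorem measurable_pathDeriv (t : ℝ) : Measurable (pathDeriv t) :=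
  Measurable.limsup fun n => by fun_prop

theorem pathDeriv_eq_of_hasDerivAt {x : ℝ → ℝ} {t d : ℝ} (h : HasDerivAt x d t) :
    pathDeriv t x = d := by
  refine Tendsto.limsup_eq ?_
  have h1 : Tendsto (fun n : ℕ => t + 1 / ((n : ℝ) + 1)) atTop (𝓝[≠] t) := by
    refine tendsto_nhdsWithin_iff.2 ⟨?_, Eventually.of_forall fun n => ?_⟩
    · simpa using tendsto_one_div_add_atTop_nhds_zero_nat.const_add t
    · have : (0 : ℝ) < 1 / ((n : ℝ) + 1) := by positivity
      simp only [mem_compl_iff, mem_singleton_iff]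
      linarith
  refine ((hasDerivAt_iff_tendsto_slope.1 h).comp h1).congr fun n => ?_
  simp only [Function.comp_apply, slope_def_field]
  field_simp
  simp

/-- Setting the path to zero on a measurable null set containing the bad outcomes makes every path
`C¹`, as the pathwise area formula requires. -/
theorem exists_contDiff_modification {X : ℝ → S → ℝ}
    (hX : ∀ t, Measurable (X t)) (hC : ∀ᵐ ω ∂μ, ContDiff ℝ 1 fun t => X t ω) :
    ∃ Y : ℝ → S → ℝ, (∀ t, Measurable (Y t)) ∧ (∀ ω, ContDiff ℝ 1 fun t => Y t ω) ∧
      ∀ᵐ ω ∂μ, ∀ t, Y t ω = X t ω := by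
  classical
  obtain ⟨T, hTC, hTm, hT⟩ := exists_measurable_superset_of_null hC
  refine ⟨fun t => T.piecewise 0 (X t), fun t => measurable_const.piecewise hTm (hX t),
    fun ω => ?_, ?_⟩
  · by_cases h : ω ∈ T
    · simpa [h] using contDiff_const
    · have : ContDiff ℝ 1 fun t => X t ω := by
        by_contra h'
        exact h (hTC h')
      simpa [h] using this
  · filter_upwards [measure_eq_zero_iff_ae_notMem.1 hT] with ω hω t
    simp [hω]

/-- Rice's formula for the level crossing rate of a process with almost surely `C¹` paths whose
derivative at each time is independent of its value. -/
theorem levelCrossingRate_eq [IsProbabilityMeasure μ] {X : ℝ → S → ℝ}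
    (hX : ∀ t, Measurable (X t)) (hC : ∀ᵐ ω ∂μ, ContDiff ℝ 1 fun t => X t ω)
    {ν γ : Measure ℝ} [SFinite ν] [SFinite γ]
    (hlaw : ∀ t, μ.map (fun ω => (X t ω, deriv (fun s => X s ω) t)) = ν.prod γ)
    {f : ℝ → ℝ≥0∞} (hf : Measurable f) (hν : ν = volume.withDensity f) {a b : ℝ} (hab : a < b) :
    ∀ᵐ z : ℝ, levelCrossingRate μ X a b z = (∫⁻ y, ENNReal.ofReal (-y) ∂γ) * f z := by
  obtain ⟨Y, hY, hYC, hXY⟩ := exists_contDiff_modification hX hC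
  have hYd : ∀ ω t, HasDerivAt (fun s => Y s ω) (deriv (fun s => Y s ω) t) t := fun ω t =>
    ((hYC ω).differentiable one_ne_zero t).hasDerivAt
  have hYm : ∀ t, Measurable fun ω => deriv (fun s => Y s ω) t := fun t => by
    simp_rw [← fun ω => pathDeriv_eq_of_hasDerivAt (hYd ω t)]
    exact (measurable_pathDeriv t).comp (measurable_pi_lambda _ hY)
  have hpath : ∀ᵐ ω ∂μ, (fun s => Y s ω) = fun s => X s ω := by
    filter_upwards [hXY] with ω h using funext h
  have hlaw' : ∀ t, μ.map (fun ω => (Y t ω, deriv (fun s => Y s ω) t)) = ν.prod γ := fun t => by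
    rw [← hlaw t]
    refine Measure.map_congr ?_
    filter_upwards [hXY, hpath] with ω h1 h2
    rw [h1, h2]
  filter_upwards [lintegral_encard_isDowncrossing hY hYm hYd
    (fun ω => (hYC ω).continuous_deriv le_rfl) hlaw' hf hν a b] with z hz
  have hba : ENNReal.ofReal (b - a) ≠ 0 := by simpa using hab
  rw [levelCrossingRate]
  have : ∫⁻ ω, ({t ∈ Ioc a b | IsDowncrossing (fun s => X s ω) z t}.encard : ℝ≥0∞) ∂μ =
      ∫⁻ ω, ({t ∈ Ioc a b | IsDowncrossing (fun s => Y s ω) z t}.encard : ℝ≥0∞) ∂μ := by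
    refine lintegral_congr_ae ?_
    filter_upwards [hpath] with ω h
    rw [h]
  rw [this, hz, mul_assoc, mul_comm, ENNReal.mul_div_cancel_right hba ENNReal.ofReal_ne_top]

end Rice

/-! ### Sums of independent variables -/

section Sums

variable {S : Type*} [MeasurableSpace S] {μ : Measure S} [IsProbabilityMeasure μ]
  {ι : Type*}

/-- Recasts a pair as a family over `Bool`, the form consumed by `iIndepFun_uncurry'`. -/
theorem iIndepFun_cond_of_indepFun {U V : S → ℝ} (hU : Measurable U) (hV : Measurable V)
    (h : IndepFun U V μ) : iIndepFun (fun b : Bool => cond b U V) μ := by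
  have hm : ∀ b, Measurable (cond b U V) := fun b => by cases b <;> assumption
  rw [iIndepFun_iff_map_fun_eq_pi_map fun b => (hm b).aemeasurable]
  have : ∀ b, IsProbabilityMeasure (μ.map (cond b U V)) := fun b =>
    Measure.isProbabilityMeasure_map (hm b).aemeasurable
  refine (Measure.pi_eq fun s hs => ?_).symm
  rw [Measure.map_apply (measurable_pi_lambda _ hm) (MeasurableSet.univ_pi hs), Fintype.prod_bool,
    Measure.map_apply (hm _) (hs _), Measure.map_apply (hm _) (hs _)]
  have : (fun ω b => cond b U V ω) ⁻¹' univ.pi s = U ⁻¹' s true ∩ V ⁻¹' s false := by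
    ext ω
    simp [and_comm]
  rw [this]
  exact h.measure_inter_preimage_eq_mul _ _ (hs _) (hs _)

/-- If the pairs `(U i, V i)` are independent and `U i` is independent of `V i` for each `i`, then
the sums of the `U i` and of the `V i` are independent. -/
theorem indepFun_sum_sum [Fintype ι] {U V : ι → S → ℝ} (hU : ∀ i, Measurable (U i))
    (hV : ∀ i, Measurable (V i)) (h : iIndepFun (fun i ω => (U i ω, V i ω)) μ)
    (hUV : ∀ i, IndepFun (U i) (V i) μ) :
    IndepFun (fun ω => ∑ i, U i ω) (fun ω => ∑ i, V i ω) μ := by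
  classical
  have hm : ∀ i b, Measurable (cond b (U i) (V i)) := fun i b => by
    cases b
    · exact hV i
    · exact hU i
  have h1 : iIndepFun (fun i ω (b : Bool) => cond b (U i) (V i) ω) μ := by
    have := h.comp (fun _ p (b : Bool) => cond b p.1 p.2) fun _ =>
      measurable_pi_lambda _ fun b => by
        cases b
        · exact measurable_snd
        · exact measurable_fst
    refine this.congr fun i => Eventually.of_forall fun ω => ?_
    funext b
    cases b <;> rfl
  -- All the `U i` and `V i` together form one independent family over `ι × Bool`; the two sums use
  -- its disjoint `true` and `false` slices.
  have h2 := iIndepFun_uncurry' (X := fun i (b : Bool) => cond b (U i) (V i)) hm h1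
    fun i => iIndepFun_cond_of_indepFun (hU i) (hV i) (hUV i)
  have h3 := h2.indepFun_finset (Finset.univ ×ˢ {true}) (Finset.univ ×ˢ {false})
    (by simp [Finset.disjoint_left]) fun p => hm p.1 p.2
  have h4 := h3.comp (φ := fun g => ∑ p, g p) (ψ := fun g => ∑ p, g p)
    (Finset.measurable_sum _ fun p _ => measurable_pi_apply p)
    (Finset.measurable_sum _ fun p _ => measurable_pi_apply p)
  convert h4 using 1
  · funext ω
    simp only [Function.comp_apply]
    rw [Finset.sum_coe_sort (Finset.univ ×ˢ {true}) fun p : ι × Bool => cond p.2 (U p.1) (V p.1) ω,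
      Finset.sum_product]
    simp
  · funext ω
    simp only [Function.comp_apply]
    rw [Finset.sum_coe_sort (Finset.univ ×ˢ {false}) fun p : ι × Bool => cond p.2 (U p.1) (V p.1) ω,
      Finset.sum_product]
    simp

theorem map_sum_eq_gaussianReal {V : ι → S → ℝ} (hV : ∀ i, Measurable (V i)) (h : iIndepFun V μ)
    {v : NNReal} (hlaw : ∀ i, μ.map (V i) = gaussianReal 0 v) (s : Finset ι) :
    μ.map (∑ i ∈ s, V i) = gaussianReal 0 (s.card * v) := by
  classical
  induction s using Finset.induction_on with
  | empty =>
    -- The empty sum has the Dirac law at `0`, which is `gaussianReal 0 0`.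
    simp [Measure.map_const, Pi.zero_def]
  | insert i s hi ih =>
    rw [Finset.sum_insert hi, add_comm, gaussianReal_add_gaussianReal_of_indepFun
      (h.indepFun_finsetSum_of_notMem hV hi) ih (hlaw i), Finset.card_insert_of_notMem hi]
    congr 1
    · simp
    · push_cast
      ring

/-- Convolving with one absolutely continuous law already gives an absolutely continuous law, so it
is enough to split off one summand. -/
theorem map_sum_absolutelyContinuous [Fintype ι] [Nonempty ι] {U : ι → S → ℝ} (hU : ∀ i, Measurable (U i))
    (h : iIndepFun U μ) (hac : ∀ i, μ.map (U i) ≪ volume) : μ.map (∑ i, U i) ≪ volume := by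
  classical
  obtain ⟨i⟩ := ‹Nonempty ι›
  rw [← Finset.sum_erase_add _ _ (Finset.mem_univ i),
    (h.indepFun_finsetSum_of_notMem hU (Finset.notMem_erase i _)).map_add_eq_map_conv_map
      (by fun_prop) (hU i)]
  exact Measure.conv_absolutelyContinuous (hac i)

/-- Zero variance would make `X` almost surely constant, giving its law an atom. This yields `V > 0`
without any inequality between Gamma values. -/
theorem variance_pos_of_absolutelyContinuous {X : S → ℝ} (hX : MemLp X 2 μ)
    (hac : μ.map X ≪ volume) : 0 < Var[X; μ] := by
  refine lt_of_le_of_ne (variance_nonneg _ _) fun h0 => ?_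
  have hX' := (hX.aestronglyMeasurable).aemeasurable
  have h1 : X =ᵐ[μ] fun _ => μ[X] := by
    rw [← evariance_eq_zero_iff hX', ← hX.ofReal_variance_eq, ← h0, ENNReal.ofReal_zero]
  have h2 : μ.map X {μ[X]} = 0 := hac Real.volume_singleton
  rw [Measure.map_apply_of_aemeasurable hX' (measurableSet_singleton _)] at h2
  have h3 : ∀ᵐ ω ∂μ, False := by
    filter_upwards [h1, measure_eq_zero_iff_ae_notMem.1 h2] with ω h4 h5 using h5 h4
  exact h3.exists.choose_spec

end Sums

/-! ### Gaussian negative part and Nakagami moments -/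

section Laws

/-- The mean of the negative part of a centred Gaussian variable. -/
theorem lintegral_ofReal_neg_gaussianReal {v : NNReal} (hv : v ≠ 0) :
    ∫⁻ y, ENNReal.ofReal (-y) ∂(gaussianReal 0 v) =
      ENNReal.ofReal (√v / √(2 * Real.pi)) := by
  have hv' : (0 : ℝ) < v := by positivity
  have hsymm : ∫⁻ y, ENNReal.ofReal (-y) ∂(gaussianReal 0 v) =
      ∫⁻ y, ENNReal.ofReal y ∂(gaussianReal 0 v) := by
    conv_rhs => rw [← neg_zero, ← gaussianReal_map_neg]
    rw [lintegral_map ENNReal.measurable_ofReal measurable_neg]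
  have hpdf : ∀ y ∈ Ioi (0 : ℝ), gaussianPDFReal 0 v y * y =
      (√(2 * Real.pi * v))⁻¹ * (y ^ (1 : ℝ) * Real.exp (-(1 / (2 * v)) * y ^ (2 : ℝ))) := by
    intro y _
    rw [gaussianPDFReal, Real.rpow_one, Real.rpow_two]
    have : -(y - 0) ^ 2 / (2 * (v : ℝ)) = -(1 / (2 * v)) * y ^ 2 := by ring
    rw [this]
    ring
  have hint : IntegrableOn (fun y => gaussianPDFReal 0 v y * y) (Ioi 0) := by
    rw [integrableOn_congr_fun hpdf measurableSet_Ioi]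
    exact (integrableOn_rpow_mul_exp_neg_mul_rpow (by norm_num) (by norm_num)
      (by positivity)).const_mul _
  have h1 : ∫⁻ y, ENNReal.ofReal y ∂(gaussianReal 0 v) =
      ∫⁻ y in Ioi 0, ENNReal.ofReal (gaussianPDFReal 0 v y * y) := by
    rw [gaussianReal_of_var_ne_zero _ hv, lintegral_withDensity_eq_lintegral_mul _
      (measurable_gaussianPDF 0 v) ENNReal.measurable_ofReal, ← lintegral_indicator measurableSet_Ioi]
    refine lintegral_congr fun y => ?_
    by_cases hy : 0 < y
    · rw [indicator_of_mem (mem_Ioi.2 hy), Pi.mul_apply, gaussianPDF,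
        ENNReal.ofReal_mul (gaussianPDFReal_nonneg _ _ _)]
    · rw [indicator_of_notMem (by simpa using hy), Pi.mul_apply,
        ENNReal.ofReal_of_nonpos (not_lt.1 hy), mul_zero]
  rw [hsymm, h1, ← ofReal_integral_eq_lintegral_ofReal hint]
  · congr 1
    rw [setIntegral_congr_fun measurableSet_Ioi hpdf, integral_const_mul,
      integral_rpow_mul_exp_neg_mul_rpow (by norm_num) (by norm_num) (by positivity)]
    have h2 : (-((1 : ℝ) + 1) / 2) = -1 := by norm_num
    have h3 : (((1 : ℝ) + 1) / 2) = 1 := by norm_num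
    rw [h2, h3, Real.Gamma_one, Real.rpow_neg_one, Real.sqrt_mul (by positivity)]
    have h4 : √(v : ℝ) ≠ 0 := by positivity
    have h5 : √(2 * Real.pi) ≠ 0 := by positivity
    field_simp
    rw [Real.sq_sqrt hv'.le]
  · filter_upwards [ae_restrict_mem measurableSet_Ioi] with y hy
    exact mul_nonneg (gaussianPDFReal_nonneg _ _ _) (le_of_lt hy)

variable {m Ω : ℝ}

theorem nakagamiPDF_nonneg (hm : 0 < m) (hΩ : 0 < Ω) (x : ℝ) : 0 ≤ nakagamiPDF m Ω x := by
  rw [nakagamiPDF]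
  split_ifs with h
  · have := Real.Gamma_pos_of_pos hm
    positivity
  · exact le_rfl

theorem measurable_nakagamiPDF : Measurable (nakagamiPDF m Ω) := by
  unfold nakagamiPDF
  exact Measurable.ite measurableSet_Ici (by fun_prop) measurable_const

/-- Puts the moment integrand in the form of a Gamma integral. Equality is only almost everywhere:
at `x = 0` the sides differ when `m = 1 / 2` and `k = 0`. -/
theorem pow_mul_nakagamiPDF (hm : 0 < m) (hΩ : 0 < Ω) (k : ℕ) :
    (fun x => x ^ k * nakagamiPDF m Ω x) =ᵐ[volume] (Ioi 0).indicator fun x =>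
      2 * (m / Ω) ^ m / Real.Gamma m *
        (x ^ (2 * m - 1 + k) * Real.exp (-(m / Ω) * x ^ (2 : ℝ))) := by
  filter_upwards [measure_eq_zero_iff_ae_notMem.1 (Real.volume_singleton (a := 0))] with x hx
  rcases lt_or_gt_of_ne (show x ≠ 0 from hx) with h | h
  · rw [indicator_of_notMem (by simpa using h.le), nakagamiPDF, if_neg (not_le.2 h), mul_zero]
  · rw [indicator_of_mem (mem_Ioi.2 h), nakagamiPDF, if_pos h.le, Real.rpow_add h,
      Real.rpow_natCast, Real.div_rpow hm.le hΩ.le, Real.rpow_two]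
    have h1 : -m * x ^ 2 / Ω = -(m / Ω) * x ^ 2 := by ring
    have h2 : Ω ^ m ≠ 0 := by positivity
    have h3 : Real.Gamma m ≠ 0 := (Real.Gamma_pos_of_pos hm).ne'
    rw [h1]
    field_simp

theorem integrable_pow_nakagamiMeasure (hm : 0 < m) (hΩ : 0 < Ω) (k : ℕ) :
    Integrable (fun x => x ^ k) (nakagamiMeasure m Ω) := by
  rw [nakagamiMeasure, integrable_withDensity_iff measurable_nakagamiPDF.ennreal_ofReal
    (by simp)]
  simp_rw [ENNReal.toReal_ofReal (nakagamiPDF_nonneg hm hΩ _)]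
  rw [integrable_congr (pow_mul_nakagamiPDF hm hΩ k), integrable_indicator_iff measurableSet_Ioi]
  exact (integrableOn_rpow_mul_exp_neg_mul_rpow (by have := k.cast_nonneg (α := ℝ); linarith)
    (by norm_num) (by positivity)).const_mul _

theorem integral_pow_nakagamiMeasure (hm : 0 < m) (hΩ : 0 < Ω) (k : ℕ) :
    ∫ x, x ^ k ∂(nakagamiMeasure m Ω) =
      Real.Gamma (m + k / 2) / Real.Gamma m * (Ω / m) ^ ((k : ℝ) / 2) := by
  rw [nakagamiMeasure, integral_withDensity_eq_integral_toReal_smul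
    measurable_nakagamiPDF.ennreal_ofReal (by simp)]
  simp_rw [ENNReal.toReal_ofReal (nakagamiPDF_nonneg hm hΩ _), smul_eq_mul,
    mul_comm (nakagamiPDF m Ω _)]
  rw [integral_congr_ae (pow_mul_nakagamiPDF hm hΩ k), integral_indicator measurableSet_Ioi,
    integral_const_mul, integral_rpow_mul_exp_neg_mul_rpow (by norm_num)
      (by have := k.cast_nonneg (α := ℝ); linarith) (by positivity)]
  have h1 : -(2 * m - 1 + (k : ℝ) + 1) / 2 = -m + -(k / 2) := by ring
  have h2 : (2 * m - 1 + (k : ℝ) + 1) / 2 = m + k / 2 := by ring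
  have h0 : 0 < m / Ω := by positivity
  rw [h1, h2, Real.rpow_add h0, Real.rpow_neg h0.le, Real.rpow_neg h0.le,
    ← Real.inv_rpow h0.le (k / 2 : ℝ), inv_div]
  have h3 : (m / Ω) ^ m ≠ 0 := by positivity
  have h4 : Real.Gamma m ≠ 0 := (Real.Gamma_pos_of_pos hm).ne'
  field_simp

end Laws

/-! ### The channel coefficient and its derivative -/

section Fading

variable {S : Type*} [MeasurableSpace S] {μ : Measure S} {M : ℕ}
  {m Ω fD : ℝ} {R : Fin M → ℝ → S → ℝ}

theorem IsNakagamiFading.map_eq (hR : IsNakagamiFading μ m Ω fD R) (i : Fin M) (t : ℝ) :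
    μ.map (R i t) = nakagamiMeasure m Ω := by
  have h := hR.law i t
  -- Taking a marginal of the pair requires its a.e. measurability, obtained by comparing `deriv`
  -- with the measurable `pathDeriv`.
  have hm : AEMeasurable (fun ω => (R i t ω, deriv (fun s => R i s ω) t)) μ := by
    refine (hR.measurable i t).aemeasurable.prodMk ?_
    refine ⟨fun ω => pathDeriv t fun s => R i s ω,
      (measurable_pathDeriv t).comp (measurable_pi_lambda _ fun s => hR.measurable i s), ?_⟩
    filter_upwards [hR.contDiff i] with ω hω
    exact (pathDeriv_eq_of_hasDerivAt (hω.differentiable one_ne_zero t).hasDerivAt).symm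
  have h2 := congrArg (Measure.map Prod.fst) h
  rw [AEMeasurable.map_map_of_aemeasurable measurable_fst.aemeasurable hm, ← Measure.fst,
    Measure.fst_prod] at h2
  exact h2

theorem IsNakagamiFading.map_pathDeriv_eq (hR : IsNakagamiFading μ m Ω fD R) (i : Fin M) (t : ℝ) :
    μ.map (fun ω => (R i t ω, pathDeriv t fun s => R i s ω)) =
      (nakagamiMeasure m Ω).prod (gaussianReal 0 (Real.pi ^ 2 * fD ^ 2 * Ω / m).toNNReal) := by
  rw [← hR.law i t]
  refine Measure.map_congr ?_
  filter_upwards [hR.contDiff i] with ω hω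
  rw [pathDeriv_eq_of_hasDerivAt (hω.differentiable one_ne_zero t).hasDerivAt]

theorem IsNakagamiFading.isProbabilityMeasure [IsProbabilityMeasure μ] (hR : IsNakagamiFading μ m Ω fD R) (i : Fin M) :
    IsProbabilityMeasure (nakagamiMeasure m Ω) := by
  rw [← hR.map_eq i 0]
  exact Measure.isProbabilityMeasure_map (hR.measurable i 0).aemeasurable

theorem IsNakagamiFading.measurable_pathDeriv (hR : IsNakagamiFading μ m Ω fD R)
    (i : Fin M) (t : ℝ) : Measurable fun ω => pathDeriv t fun s => R i s ω :=
  (RISOutage.measurable_pathDeriv t).comp (measurable_pi_lambda _ fun s => hR.measurable i s)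

theorem IsNakagamiFading.measurable_channel (hR : IsNakagamiFading μ m Ω fD R) (t : ℝ) :
    Measurable (channel R t) :=
  Finset.measurable_fun_sum _ fun i _ => hR.measurable i t

theorem channel_eq_sum {S : Type*} {M : ℕ} (R : Fin M → ℝ → S → ℝ) (t : ℝ) : channel R t = ∑ i, R i t := by
  funext ω
  simp [channel]

theorem IsNakagamiFading.contDiff_channel (hR : IsNakagamiFading μ m Ω fD R) :
    ∀ᵐ ω ∂μ, ContDiff ℝ 1 fun t => channel R t ω := by
  filter_upwards [ae_all_iff.2 hR.contDiff] with ω hω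
  exact ContDiff.sum fun i _ => hω i

theorem IsNakagamiFading.iIndepFun_at (hR : IsNakagamiFading μ m Ω fD R) (t : ℝ) :
    iIndepFun (fun i => R i t) μ :=
  hR.indep.comp (fun _ x => x t) fun _ => measurable_pi_apply t

theorem IsNakagamiFading.map_channel_absolutelyContinuous [IsProbabilityMeasure μ] (hR : IsNakagamiFading μ m Ω fD R)
    (hM : 1 ≤ M) (t : ℝ) : μ.map (channel R t) ≪ volume := by
  have : Nonempty (Fin M) := ⟨⟨0, hM⟩⟩
  rw [channel_eq_sum]
  refine map_sum_absolutelyContinuous (fun i => hR.measurable i t) (hR.iIndepFun_at t) fun i => ?_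
  rw [hR.map_eq]
  exact withDensity_absolutelyContinuous _ _

/-- The law of the sum is determined by independence and the common marginal law, neither depending
on time. Hence one density serves at all times in Rice's formula. -/
theorem IsNakagamiFading.map_channel_eq [IsProbabilityMeasure μ] (hR : IsNakagamiFading μ m Ω fD R) (s t : ℝ) :
    μ.map (channel R s) = μ.map (channel R t) := by
  have h : ∀ t, μ.map (channel R t) =
      (Measure.pi fun _ : Fin M => nakagamiMeasure m Ω).map fun x => ∑ i, x i := by
    intro t
    have := (hR.iIndepFun_at t).map_fun_eq_pi_map fun i => (hR.measurable i t).aemeasurable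
    simp_rw [hR.map_eq] at this
    rw [← this, Measure.map_map (by fun_prop)
      (measurable_pi_lambda _ fun i => hR.measurable i t)]
    rfl
  rw [h, h]

/-- The channel coefficient is independent of its derivative, which is a centred Gaussian. -/
theorem IsNakagamiFading.map_channel_deriv_eq [IsProbabilityMeasure μ] (hR : IsNakagamiFading μ m Ω fD R) (t : ℝ) :
    μ.map (fun ω => (channel R t ω, deriv (fun s => channel R s ω) t)) =
      (μ.map (channel R t)).prod
        (gaussianReal 0 (M * (Real.pi ^ 2 * fD ^ 2 * Ω / m).toNNReal)) := by
  have hU := fun i => hR.measurable i t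
  have hV := fun i => hR.measurable_pathDeriv i t
  -- Independence of whole paths passes to these pairs because `pathDeriv t` is a measurable
  -- functional of the path.
  have hpair : iIndepFun (fun i ω => (R i t ω, pathDeriv t fun s => R i s ω)) μ :=
    hR.indep.comp (fun _ x => (x t, pathDeriv t x)) fun _ =>
      (measurable_pi_apply t).prodMk (RISOutage.measurable_pathDeriv t)
  have hVlaw : ∀ i, μ.map (fun ω => pathDeriv t fun s => R i s ω) =
      gaussianReal 0 (Real.pi ^ 2 * fD ^ 2 * Ω / m).toNNReal := by
    intro i
    have := hR.isProbabilityMeasure i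
    have h := congrArg (Measure.map Prod.snd) (hR.map_pathDeriv_eq i t)
    rw [Measure.map_map measurable_snd ((hU i).prodMk (hV i)), ← Measure.snd,
      Measure.snd_prod] at h
    exact h
  have hUV : ∀ i, IndepFun (R i t) (fun ω => pathDeriv t fun s => R i s ω) μ := by
    intro i
    rw [indepFun_iff_map_prod_eq_prod_map_map (hU i).aemeasurable (hV i).aemeasurable,
      hVlaw, hR.map_eq, hR.map_pathDeriv_eq]
  have hVind : iIndepFun (fun i ω => pathDeriv t fun s => R i s ω) μ :=
    hR.indep.comp (fun _ x => pathDeriv t x) fun _ => RISOutage.measurable_pathDeriv t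
  have hsum : μ.map (fun ω => ∑ i, pathDeriv t fun s => R i s ω) =
      gaussianReal 0 (M * (Real.pi ^ 2 * fD ^ 2 * Ω / m).toNNReal) := by
    have := map_sum_eq_gaussianReal hV hVind hVlaw Finset.univ
    rw [Finset.card_univ, Fintype.card_fin] at this
    rw [← this]
    congr 1
    funext ω
    simp
  have hind := indepFun_sum_sum hU hV hpair hUV
  rw [indepFun_iff_map_prod_eq_prod_map_map
    (Finset.measurable_fun_sum _ fun i _ => hU i).aemeasurable
    (Finset.measurable_fun_sum _ fun i _ => hV i).aemeasurable, hsum] at hind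
  refine Eq.trans (Measure.map_congr ?_) hind
  filter_upwards [ae_all_iff.2 hR.contDiff] with ω hω
  have hd := fun i => ((hω i).differentiable one_ne_zero t).hasDerivAt
  have h1 : HasDerivAt (fun s => channel R s ω) (∑ i, deriv (fun s => R i s ω) t) t :=
    HasDerivAt.fun_sum fun i _ => hd i
  rw [h1.deriv]
  simp_rw [pathDeriv_eq_of_hasDerivAt (hd _)]
  rfl

theorem IsNakagamiFading.integral_pow (hm : 0 < m) (hΩ : 0 < Ω)
    (hR : IsNakagamiFading μ m Ω fD R) (i : Fin M) (t : ℝ)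
    (k : ℕ) : ∫ ω, R i t ω ^ k ∂μ =
      Real.Gamma (m + k / 2) / Real.Gamma m * (Ω / m) ^ ((k : ℝ) / 2) := by
  rw [← integral_pow_nakagamiMeasure hm hΩ, ← hR.map_eq i t,
    integral_map (hR.measurable i t).aemeasurable (by fun_prop)]

theorem IsNakagamiFading.memLp_two (hm : 0 < m) (hΩ : 0 < Ω)
    (hR : IsNakagamiFading μ m Ω fD R) (i : Fin M) (t : ℝ) :
    MemLp (R i t) 2 μ := by
  rw [memLp_two_iff_integrable_sq (hR.measurable i t).aestronglyMeasurable]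
  have h := integrable_pow_nakagamiMeasure hm hΩ 2
  rw [← hR.map_eq i t] at h
  exact h.comp_measurable (hR.measurable i t)

theorem IsNakagamiFading.memLp_channel [IsProbabilityMeasure μ] (hm : 0 < m) (hΩ : 0 < Ω)
    (hR : IsNakagamiFading μ m Ω fD R) (t : ℝ) :
    MemLp (channel R t) 2 μ := by
  rw [channel_eq_sum]
  exact memLp_finsetSum' _ fun i _ => hR.memLp_two hm hΩ i t

theorem IsNakagamiFading.integral_channel [IsProbabilityMeasure μ] (hm : 0 < m) (hΩ : 0 < Ω)
    (hR : IsNakagamiFading μ m Ω fD R) (t : ℝ) :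
    μ[channel R t] = approxMean M m Ω := by
  have h : ∀ i, ∫ ω, R i t ω ∂μ =
      Real.Gamma (m + 1 / 2) / Real.Gamma m * (Ω / m) ^ (1 / 2 : ℝ) := fun i => by
    simpa using hR.integral_pow hm hΩ i t 1
  simp only [channel]
  rw [integral_finsetSum _ fun i _ => (hR.memLp_two hm hΩ i t).integrable one_le_two]
  simp_rw [h]
  rw [Finset.sum_const, Finset.card_univ, Fintype.card_fin, nsmul_eq_mul, approxMean]
  ring

theorem IsNakagamiFading.variance_channel [IsProbabilityMeasure μ] (hm : 0 < m) (hΩ : 0 < Ω)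
    (hR : IsNakagamiFading μ m Ω fD R) (t : ℝ) :
    Var[channel R t; μ] = approxVar M m Ω := by
  have h1 : ∀ i, ∫ ω, R i t ω ∂μ =
      Real.Gamma (m + 1 / 2) / Real.Gamma m * (Ω / m) ^ (1 / 2 : ℝ) := fun i => by
    simpa using hR.integral_pow hm hΩ i t 1
  have hG : Real.Gamma m ≠ 0 := (Real.Gamma_pos_of_pos hm).ne'
  -- The second moment is `Γ(m + 1) / Γ(m) * (Ω / m)`, which the functional equation of Gamma
  -- reduces to `Ω`.
  have h2 : ∀ i, ∫ ω, R i t ω ^ 2 ∂μ = Ω := fun i => by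
    have := hR.integral_pow hm hΩ i t 2
    rw [this, Nat.cast_ofNat, div_self two_ne_zero, Real.rpow_one, Real.Gamma_add_one hm.ne']
    field_simp
  have hv : ∀ i, Var[R i t; μ] =
      Ω * (1 - 1 / m * (Real.Gamma (m + 1 / 2) / Real.Gamma m) ^ 2) := fun i => by
    rw [variance_eq_sub (hR.memLp_two hm hΩ i t), h1]
    simp only [Pi.pow_apply]
    rw [h2, mul_pow, ← Real.rpow_natCast ((Ω / m) ^ (1 / 2 : ℝ)),
      ← Real.rpow_mul (by positivity)]
    norm_num
    field_simp
  rw [channel_eq_sum, IndepFun.variance_sum (fun i _ => hR.memLp_two hm hΩ i t)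
    fun i _ j _ hij => (hR.iIndepFun_at t).indepFun hij]
  simp_rw [hv]
  rw [Finset.sum_const, Finset.card_univ, Fintype.card_fin, nsmul_eq_mul, approxVar]
  ring

end Fading

/-! ### The Gaussian distribution function in terms of `erf` -/

section Gaussian

theorem outageOfPDF_gaussianPDFReal (E : ℝ) {V : NNReal} (hV : V ≠ 0) (z : ℝ) :
    outageOfPDF (gaussianPDFReal E V) z = 1 / 2 * (1 + erf ((z - E) / √(2 * V))) := by
  have hV' : (0 : ℝ) < V := by positivity
  have hc : 0 < √(2 * (V : ℝ)) := by positivity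
  have hint : Integrable fun u : ℝ => Real.exp (-u ^ 2) := by
    simpa using integrable_exp_neg_mul_sq one_pos
  have hpdf : ∀ x, gaussianPDFReal E V x = (√Real.pi)⁻¹ * ((√(2 * V))⁻¹ *
      Real.exp (-((√(2 * V))⁻¹ * (x - E)) ^ 2)) := by
    intro x
    rw [gaussianPDFReal, mul_pow, inv_pow, Real.sq_sqrt (by positivity), ← mul_assoc, ← mul_inv,
      ← Real.sqrt_mul Real.pi_pos.le]
    congr 2
    · ring_nf
    · ring
  have hhalf : ∫ u in Iic (0 : ℝ), Real.exp (-u ^ 2) = √Real.pi / 2 := by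
    have h := integral_gaussian_Ioi 1
    have h2 := integral_comp_neg_Iic (0 : ℝ) fun u => Real.exp (-u ^ 2)
    simp only [neg_sq, neg_zero] at h2
    rw [h2]
    simpa using h
  have hsub : outageOfPDF (gaussianPDFReal E V) z =
      (√Real.pi)⁻¹ * ∫ u in Iic ((z - E) / √(2 * V)), Real.exp (-u ^ 2) := by
    -- Written with indicators, the substitution `u = (x - E) / √(2V)` becomes a translation and a
    -- scaling of an integral over the whole line.
    set G : ℝ → ℝ := (Iic ((z - E) / √(2 * V))).indicator fun u => Real.exp (-u ^ 2)
    have h1 : ∀ x, (Iic z).indicator (gaussianPDFReal E V) x =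
        (√Real.pi)⁻¹ * ((√(2 * V))⁻¹ * G ((√(2 * V))⁻¹ * (x - E))) := by
      intro x
      have hiff : (√(2 * V))⁻¹ * (x - E) ≤ (z - E) / √(2 * V) ↔ x ≤ z := by
        rw [inv_mul_eq_div, div_le_div_iff_of_pos_right hc, sub_le_sub_iff_right]
      by_cases hx : x ≤ z
      · rw [indicator_of_mem (mem_Iic.2 hx), hpdf]
        simp only [G]
        rw [indicator_of_mem (mem_Iic.2 (hiff.2 hx))]
      · rw [indicator_of_notMem (by simpa using hx)]
        simp only [G]
        rw [indicator_of_notMem (fun h => hx (hiff.1 (mem_Iic.1 h))), mul_zero, mul_zero]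
    rw [outageOfPDF, ← integral_indicator measurableSet_Iic, ← integral_indicator measurableSet_Iic]
    simp_rw [h1]
    rw [integral_const_mul, integral_const_mul,
      integral_sub_right_eq_self (fun x => G ((√(2 * V))⁻¹ * x)) E, Measure.integral_comp_mul_left,
      inv_inv, abs_of_pos hc, smul_eq_mul, inv_mul_cancel_left₀ hc.ne']
  rw [hsub, erf, ← intervalIntegral.integral_Iic_sub_Iic hint.integrableOn hint.integrableOn, hhalf]
  have : √Real.pi ≠ 0 := by positivity
  field_simp
  ring

end Gaussian

end RISOutage

/-! ### Assembly of the result -/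

theorem corollary2 {S : Type*} [MeasurableSpace S] (μ : Measure S) [IsProbabilityMeasure μ]
    (M : ℕ) (hM : 1 ≤ M) (m Ω fD : ℝ) (hm : 1 / 2 ≤ m) (hΩ : 0 < Ω) (hfD : 0 < fD)
    (R : Fin M → ℝ → S → ℝ) (hR : RISOutage.IsNakagamiFading μ m Ω fD R) :
    -- the channel coefficient has a density `f_H`, and the mean and variance of `H̃`
    (∀ t, HasPDF (RISOutage.channel R t) μ volume ∧
      μ[RISOutage.channel R t] = RISOutage.approxMean M m Ω ∧
      Var[RISOutage.channel R t; μ] = RISOutage.approxVar M m Ω) ∧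
    0 < RISOutage.approxVar M m Ω ∧
    -- exact outage probability, and exact rate `L(z) = f_H(z) σ / √(2π)`
    (∀ t z, μ {ω | RISOutage.channel R t ω ≤ z} = ENNReal.ofReal (RISOutage.outageOfPDF
      (fun x => (pdf (RISOutage.channel R t) μ volume x).toReal) z)) ∧
    (∀ t a b, a < b → ∀ᵐ z : ℝ, RISOutage.levelCrossingRate μ (RISOutage.channel R) a b z =
      ENNReal.ofReal (RISOutage.rateOfPDF
        (fun x => (pdf (RISOutage.channel R t) μ volume x).toReal)
        (RISOutage.sigmaDot M m Ω fD) z)) ∧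
    -- the same quantities with `f_H` replaced by the density of `H̃`
    (∀ z, RISOutage.outageOfPDF (RISOutage.approxPDF M m Ω) z =
      1 / 2 * (1 + RISOutage.erf
        ((z - RISOutage.approxMean M m Ω) / √(2 * RISOutage.approxVar M m Ω)))) ∧
    (∀ z, RISOutage.aodOfPDF (RISOutage.approxPDF M m Ω) (RISOutage.sigmaDot M m Ω fD) z =
      2 * RISOutage.outageOfPDF (RISOutage.approxPDF M m Ω) z *
          √(m * RISOutage.approxVar M m Ω) /
        (Real.exp (-(z - RISOutage.approxMean M m Ω) ^ 2 / (2 * RISOutage.approxVar M m Ω)) *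
          fD * √(M * Ω))) := by
  have hm0 : 0 < m := by linarith
  have hM0 : (0 : ℝ) < M := by exact_mod_cast hM
  have hpdf : ∀ t, HasPDF (RISOutage.channel R t) μ volume := fun t =>
    (hasPDF_iff_of_aemeasurable (hR.measurable_channel t).aemeasurable).2
      ⟨inferInstance, hR.map_channel_absolutelyContinuous hM t⟩
  have hVpos : 0 < RISOutage.approxVar M m Ω := by
    rw [← hR.variance_channel hm0 hΩ 0]
    exact RISOutage.variance_pos_of_absolutelyContinuous (hR.memLp_channel hm0 hΩ 0)
      (hR.map_channel_absolutelyContinuous hM 0)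
  have hVnn : (RISOutage.approxVar M m Ω).toNNReal ≠ 0 := by simpa using hVpos
  have hVcoe : ((RISOutage.approxVar M m Ω).toNNReal : ℝ) = RISOutage.approxVar M m Ω :=
    Real.coe_toNNReal _ hVpos.le
  refine ⟨fun t => ⟨hpdf t, hR.integral_channel hm0 hΩ t, hR.variance_channel hm0 hΩ t⟩, hVpos,
    fun t z => ?_, fun t a b hab => ?_, fun z => ?_, fun z => ?_⟩
  · have := hpdf t
    have hfin : ∀ᵐ x : ℝ, pdf (RISOutage.channel R t) μ volume x < ∞ := pdf.ae_lt_top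
    have h1 : μ {ω | RISOutage.channel R t ω ≤ z} = ∫⁻ x in Iic z,
        pdf (RISOutage.channel R t) μ volume x := by
      rw [← map_eq_setLIntegral_pdf _ _ _ measurableSet_Iic,
        Measure.map_apply (hR.measurable_channel t) measurableSet_Iic]
      rfl
    rw [RISOutage.outageOfPDF, integral_toReal (measurable_pdf _ _ _).aemeasurable
      (ae_restrict_of_ae hfin), ← h1, ENNReal.ofReal_toReal (measure_ne_top _ _)]
  · have := hpdf t
    have hfin : ∀ᵐ x : ℝ, pdf (RISOutage.channel R t) μ volume x < ∞ := pdf.ae_lt_top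
    have hlaw : μ.map (RISOutage.channel R t) =
        volume.withDensity (pdf (RISOutage.channel R t) μ volume) :=
      (map_eq_withDensity_pdf _ _ _)
    have hσ : ((M * (Real.pi ^ 2 * fD ^ 2 * Ω / m).toNNReal : NNReal) : ℝ) =
        RISOutage.sigmaDot M m Ω fD ^ 2 := by
      rw [RISOutage.sigmaDot, mul_pow, Real.sq_sqrt (by positivity), NNReal.coe_mul,
        Real.coe_toNNReal _ (by positivity), NNReal.coe_natCast]
      field_simp
    have hσ0 : 0 < RISOutage.sigmaDot M m Ω fD := by
      rw [RISOutage.sigmaDot]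
      positivity
    have hv : (M * (Real.pi ^ 2 * fD ^ 2 * Ω / m).toNNReal : NNReal) ≠ 0 := by
      rw [← NNReal.coe_ne_zero, hσ]
      positivity
    -- The law at each time `s` is replaced by the law at the fixed time `t`, whose density appears
    -- in the conclusion.
    filter_upwards [RISOutage.levelCrossingRate_eq hR.measurable_channel hR.contDiff_channel
      (fun s => (hR.map_channel_deriv_eq s).trans (by rw [hR.map_channel_eq s t]))
      (measurable_pdf _ _ _) hlaw hab, hfin] with z hz hlt
    rw [hz, RISOutage.lintegral_ofReal_neg_gaussianReal hv, hσ, Real.sqrt_sq hσ0.le,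
      RISOutage.rateOfPDF, ENNReal.ofReal_mul ENNReal.toReal_nonneg,
      ENNReal.ofReal_toReal hlt.ne, mul_comm]
  · rw [RISOutage.approxPDF, RISOutage.outageOfPDF_gaussianPDFReal _ hVnn, hVcoe]
  · rw [RISOutage.aodOfPDF]
    generalize RISOutage.outageOfPDF (RISOutage.approxPDF M m Ω) z = P
    rw [RISOutage.rateOfPDF, RISOutage.approxPDF, gaussianPDFReal, hVcoe, RISOutage.sigmaDot]
    generalize RISOutage.approxVar M m Ω = V at *
    -- Once the roots are split, the factors `√(2π)` from the Gaussian density and from the rate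
    -- combine to `2π`, whose `π` cancels the one in `sigmaDot`.
    rw [Real.sqrt_div (by positivity), Real.sqrt_mul (by positivity) V,
      Real.sqrt_mul hm0.le V]
    have h1 : √(2 * Real.pi) ≠ 0 := by positivity
    have h2 : √(2 * Real.pi) ^ 2 = 2 * Real.pi := Real.sq_sqrt (by positivity)
    have h3 : √V ≠ 0 := by positivity
    have h4 : √m ≠ 0 := by positivity
    have h5 : √(M * Ω) ≠ 0 := by positivity
    field_simp
    rw [h2]
    ring
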